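/- Let $d\ge 1$, $a\in\mathbb{R}^d\setminus\{0\}$, let $\Sigma_X,\Sigma_Y$ be (known) positive definite $d\times d$ matrices and $\mathcal{L}_1,\mathcal{L}_2$ probability distributions on $\mathbb{R}$. For $\theta\in\mathbb{R}^d$, $\Sigma$ positive definite and $\mathcal{L}$ a probability distribution on $\mathbb{R}$, $MMN_d(\theta,a,\Sigma,\mathcal{L})$ denotes the distribution of a random vector $X$ with $X\mid V=v\sim N_d(\theta+va,\Sigma)$ and $V\sim\mathcal{L}$; its Lebesgue density is $x\mapsto \mathbb{E}\,\phi_d(x-\theta-Va;\Sigma)$, where $\phi_d(\cdot\,;\Sigma)$ is the $N_d(0,\Sigma)$ density. Let $X\mid\theta\sim MMN_d(\theta,a,\Sigma_X,\mathcal{L}_1)$ and $Y\mid\theta\sim MMN_d(\theta,a,\Sigma_Y,\mathcal{L}_2)$ be independent given the unknown $\theta\in\mathbb{R}^d$, with densities $p(\cdot\mid\theta)$ and $q(\cdot\mid\theta)$. A predictive density estimator is a jointly measurable function $\hat q(y;x)\ge 0$ with $\int_{\mathbb{R}^d}\hat q(y;x)\,dy=1$ for every $x$. Its Kullback-Leibler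 risk is $$R_{KL}(\theta,\hat q)=\int_{\mathbb{R}^d}\Big\{\int_{\mathbb{R}^d}q(y\mid\theta)\log\frac{q(y\mid\theta)}{\hat q(y;x)}\,dy\Big\}\,p(x\mid\theta)\,dx\in[0,\infty].$$ It is (location) equivariant if, for all $x,c\in\mathbb{R}^d$, $\hat q(y+c;x+c)=\hat q(y;x)$ for almost every $y$. An equivariant predictive density estimator is minimum risk equivariant (MRE) if, at every $\theta$, its risk is at most that of every equivariant predictive density estimator; a predictive density estimator is minimax if its maximal risk $\sup_\theta R_{KL}(\theta,\cdot)$ is minimal among all predictive density estimators. Let $\hat q_U$ be the Bayes predictive density for the flat prior $\pi_U(\theta)=1$, $$\hat q_U(y;x)=\frac{\int_{\mathbb{R}^d} q(y\mid\theta)\,p(x\mid\theta)\,d\theta}{\int_{\mathbb{R}^d}p(x\mid\theta)\,d\theta}=\int_{\mathbb{R}^d} q(y\mid\theta)\,p(x\mid\theta)\,d\theta,$$ where the denominator equals $1$. Then: 1. $\hat q_U$ is an MRE predictive density estimator; if $R_{KL}(\theta,\hat q_U)<\infty$ for some $\theta$, it is the only one, in the sense that every MRE predictive density estimator $\hat q$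 satisfies, for every $x$, $\hat q(y;x)=\hat q_U(y;x)$ for almost every $y$. 2. For every $x\in\mathbb{R}^d$, $\hat q_U(\cdot\,;x)$ is the density of $MMN_d(x,a,\Sigma_X+\Sigma_Y,\mathcal{L}_3)$, where $\mathcal{L}_3$ is the law of $V_2-V_1$ with $V_1\sim\mathcal{L}_1$ and $V_2\sim\mathcal{L}_2$ independent. 3. $\hat q_U$ is minimax under Kullback-Leibler loss. -/

import Mathlib

open MeasureTheory ProbabilityTheory InformationTheory
open scoped ENNReal Matrix

noncomputable section

/-- The Euclidean space `ℝ^d`, with Lebesgue measure `volume`. -/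
abbrev Vec (d : ℕ) : Type := EuclideanSpace ℝ (Fin d)

/-! ### Mean mixtures of normal distributions -/

/-- The law `MMN_d(θ, a, S, L)`: the distribution of `θ + V a + Z` with `V ∼ L` and
`Z ∼ N_d(0, S)` independent, i.e. `X | V = v ∼ N_d(θ + v a, S)` with `V ∼ L`. -/
def mmnLaw {d : ℕ} (θ a : Vec d) (S : Matrix (Fin d) (Fin d) ℝ) (L : Measure ℝ) :
    Measure (Vec d) :=
  (L.prod (multivariateGaussian (0 : Vec d) S)).map fun w => θ + w.1 • a + w.2

/-- The density `φ_d(z; S)` of the `N_d(0, S)` distribution, for `S` positive definite. -/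
def normalPDF {d : ℕ} (S : Matrix (Fin d) (Fin d) ℝ) (z : Vec d) : ℝ :=
  (Real.sqrt ((2 * Real.pi) ^ d * S.det))⁻¹ *
    Real.exp (-(1 / 2) * (z.ofLp ⬝ᵥ (S⁻¹ *ᵥ z.ofLp)))

/-- The density `x ↦ E φ_d(x - θ - V a; S)`, `V ∼ L`, of `MMN_d(θ, a, S, L)`. -/
def mmnPDF {d : ℕ} (a : Vec d) (S : Matrix (Fin d) (Fin d) ℝ) (L : Measure ℝ)
    (θ x : Vec d) : ℝ :=
  ∫ v, normalPDF S (x - θ - v • a) ∂L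

/-- The measure with Lebesgue density `f`. -/
def densMeasure {d : ℕ} (f : Vec d → ℝ) : Measure (Vec d) :=
  volume.withDensity fun x => ENNReal.ofReal (f x)

/-! ### Predictive density estimation under Kullback-Leibler loss

A model is given by two families of Lebesgue densities: `p θ` is the density of the observable `X`
and `q θ` the density of the independent future variable `Y`, given the parameter `θ ∈ ℝ^d`.
A predictive density estimator is a function `qhat`, where `qhat x` is the estimated density
of `Y` when `X = x` is observed. -/

/-- `qhat` is a predictive density estimator: jointly measurable, and a probability density
in its second argument for every value of the observation. -/
structure IsPredictiveDensity {d : ℕ} (qhat : Vec d → Vec d → ℝ) : Prop where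
  measurable : Measurable fun w : Vec d × Vec d => qhat w.1 w.2
  nonneg : ∀ x y, 0 ≤ qhat x y
  lintegral_eq_one : ∀ x, ∫⁻ y, ENNReal.ofReal (qhat x y) = 1

/-- The Kullback-Leibler divergence `ρ(f, g) = ∫ f log (f / g)` between two Lebesgue densities,
with values in `[0, ∞]`. -/
def klDens {d : ℕ} (f g : Vec d → ℝ) : ℝ≥0∞ := klDiv (densMeasure f) (densMeasure g)

/-- The Kullback-Leibler risk `R_KL(θ, qhat) = ∫ ρ(q_θ, qhat(·; x)) p(x | θ) dx`. -/
def klRisk {d : ℕ} (p q : Vec d → Vec d → ℝ) (θ : Vec d) (qhat : Vec d → Vec d → ℝ) : ℝ≥0∞ :=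
  ∫⁻ x, klDens (q θ) (qhat x) ∂(densMeasure (p θ))

/-- The Bayes predictive density for the (possibly improper) prior density `π` with respect to
the measure `ν`: the posterior expectation of `q(y | θ)` given `X = x`. -/
def bayesPredictive {d : ℕ} (p q : Vec d → Vec d → ℝ) (π : Vec d → ℝ) (ν : Measure (Vec d))
    (x y : Vec d) : ℝ :=
  (∫ θ, q θ y * p θ x * π θ ∂ν) / ∫ θ, p θ x * π θ ∂ν

/-- Equivariance under changes of location: `qhat(y + c; x + c) = qhat(y; x)`, as densities
in `y`, that is, up to a null set of `y`. -/
def IsLocationEquivariant {d : ℕ} (qhat : Vec d → Vec d → ℝ) : Prop :=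
  ∀ c x : Vec d, ∀ᵐ y, qhat (x + c) (y + c) = qhat x y

/-- `qhat` is a minimum risk equivariant (MRE) predictive density estimator. -/
structure IsMRE {d : ℕ} (p q : Vec d → Vec d → ℝ) (qhat : Vec d → Vec d → ℝ) : Prop where
  isPredictiveDensity : IsPredictiveDensity qhat
  equivariant : IsLocationEquivariant qhat
  minimum_risk : ∀ qhat' : Vec d → Vec d → ℝ, IsPredictiveDensity qhat' →
    IsLocationEquivariant qhat' → ∀ θ, klRisk p q θ qhat ≤ klRisk p q θ qhat'

/-- `qhat` is a minimax predictive density estimator: its maximal risk is minimal among all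
predictive density estimators. -/
structure IsMinimaxPredictive {d : ℕ} (p q : Vec d → Vec d → ℝ)
    (qhat : Vec d → Vec d → ℝ) : Prop where
  isPredictiveDensity : IsPredictiveDensity qhat
  minimax : ∀ qhat' : Vec d → Vec d → ℝ, IsPredictiveDensity qhat' →
    ⨆ θ, klRisk p q θ qhat ≤ ⨆ θ, klRisk p q θ qhat'

/-! ### The explicit density is the density of the mixture law -/

lemma continuous_normalPDF {d : ℕ} (S : Matrix (Fin d) (Fin d) ℝ) :
    Continuous (normalPDF S) := by
  unfold normalPDF
  have h1 : Continuous fun z : Vec d => z.ofLp := PiLp.continuous_ofLp 2 _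
  have h2 : Continuous fun z : Vec d => S⁻¹ *ᵥ z.ofLp := Continuous.matrix_mulVec continuous_const h1
  exact continuous_const.mul (Real.continuous_exp.comp (continuous_const.mul (h1.dotProduct h2)))

lemma normalPDF_nonneg {d : ℕ} (S : Matrix (Fin d) (Fin d) ℝ) (z : Vec d) :
    0 ≤ normalPDF S z := by
  unfold normalPDF; positivity

lemma normalPDF_one {d : ℕ} (z : Vec d) :
    normalPDF 1 z = (Real.sqrt ((2 * Real.pi) ^ d))⁻¹ * Real.exp (-(1 / 2) * ‖z‖ ^ 2) := by
  unfold normalPDF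
  rw [EuclideanSpace.real_norm_sq_eq]
  simp [dotProduct, pow_two]

lemma integral_cexp_normal {d : ℕ} (t : Vec d) :
    ∫ z : Vec d, Complex.exp (inner ℝ z t * Complex.I) * (normalPDF 1 z : ℂ) =
      Complex.exp (-‖t‖ ^ 2 / 2) := by
  have h := GaussianFourier.integral_cexp_neg_mul_sq_norm_add (b := (1 / 2 : ℂ)) (by norm_num)
    Complex.I t
  have hc : ((Real.sqrt ((2 * Real.pi) ^ d) : ℝ) : ℂ) ≠ 0 := by
    have : Real.sqrt ((2 * Real.pi) ^ d) ≠ 0 := by positivity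
    exact_mod_cast this
  have hs : (((Real.pi : ℝ) : ℂ) / (1 / 2)) ^ ((Module.finrank ℝ (Vec d) : ℂ) / 2) =
      ((Real.sqrt ((2 * Real.pi) ^ d) : ℝ) : ℂ) := by
    rw [Real.sqrt_eq_rpow, ← Real.rpow_natCast, ← Real.rpow_mul (by positivity),
      Complex.ofReal_cpow (by positivity)]
    congr 1
    · push_cast; ring
    · simp [div_eq_mul_inv]
  rw [hs] at h
  calc _ = ∫ z : Vec d, ((Real.sqrt ((2 * Real.pi) ^ d) : ℝ) : ℂ)⁻¹ *
        Complex.exp (-(1 / 2) * ‖z‖ ^ 2 + Complex.I * inner ℝ t z) := by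
        congr 1; ext z
        rw [normalPDF_one, Complex.exp_add, real_inner_comm]
        push_cast
        rw [mul_comm Complex.I]
        ring
    _ = _ := by
        rw [integral_const_mul, h, ← mul_assoc, inv_mul_cancel₀ hc, one_mul, Complex.I_sq]
        congr 1; ring

lemma integral_normalPDF_one {d : ℕ} : ∫ z : Vec d, normalPDF 1 z = 1 := by
  have h := integral_cexp_normal (0 : Vec d)
  simp only [inner_zero_right, Complex.ofReal_zero, zero_mul, Complex.exp_zero, one_mul,
    norm_zero] at h
  rw [integral_complex_ofReal] at h
  exact_mod_cast (by simpa using h)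

lemma stdGaussian_eq_densMeasure {d : ℕ} : stdGaussian (Vec d) = densMeasure (normalPDF 1) := by
  have hm : Measurable (normalPDF (1 : Matrix (Fin d) (Fin d) ℝ)) := (continuous_normalPDF 1).measurable
  have hi : Integrable (normalPDF (1 : Matrix (Fin d) (Fin d) ℝ)) := by
    by_contra hn
    have := integral_normalPDF_one (d := d)
    rw [integral_undef hn] at this
    exact zero_ne_one this
  have : IsFiniteMeasure (densMeasure (normalPDF (1 : Matrix (Fin d) (Fin d) ℝ))) :=
    isFiniteMeasure_withDensity_ofReal hi.2
  apply Measure.ext_of_charFun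
  ext t
  rw [charFun_stdGaussian, charFun_apply, densMeasure,
    integral_withDensity_eq_integral_toReal_smul (by fun_prop) (by simp),
    ← integral_cexp_normal t]
  congr 1; ext z
  rw [ENNReal.toReal_ofReal (normalPDF_nonneg _ _), Complex.real_smul, mul_comm]

open scoped MatrixOrder in
lemma multivariateGaussian_eq_densMeasure {d : ℕ} {S : Matrix (Fin d) (Fin d) ℝ}
    (hS : S.PosDef) : multivariateGaussian (0 : Vec d) S = densMeasure (normalPDF S) := by
  set R := CFC.sqrt S with hR
  have hRR : R * R = S := by

    exact CFC.sqrt_mul_sqrt_self S hS.posSemidef.nonneg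
  have hRs : Rᵀ = R := by

    have := (Matrix.nonneg_iff_posSemidef.mp (CFC.sqrt_nonneg S)).isHermitian
    simpa [Matrix.IsHermitian, Matrix.conjTranspose_eq_transpose_of_trivial] using this
  have hdS : 0 < S.det := hS.det_pos
  have hd2 : R.det * R.det = S.det := by rw [← Matrix.det_mul, hRR]
  have hd : R.det ≠ 0 := by
    intro h; rw [h] at hd2; simp at hd2; exact hdS.ne hd2
  set A : Vec d →L[ℝ] Vec d := Matrix.toEuclideanCLM (𝕜 := ℝ) R with hA
  have hAv : ∀ z, (A z).ofLp = R *ᵥ z.ofLp := fun z => rfl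
  have hdet : LinearMap.det (A : Vec d →ₗ[ℝ] Vec d) = R.det := by
    have : (A : Vec d →ₗ[ℝ] Vec d) =
      Matrix.toLin (EuclideanSpace.basisFun (Fin d) ℝ).toBasis
        (EuclideanSpace.basisFun (Fin d) ℝ).toBasis R := rfl
    rw [this, LinearMap.det_toLin]
  have hmap := Measure.map_linearMap_addHaar_eq_smul_addHaar (volume : Measure (Vec d))
    (f := (A : Vec d →ₗ[ℝ] Vec d)) (by rwa [hdet])
  rw [hdet] at hmap
  have hval : ∀ z, normalPDF 1 z = |R.det| * normalPDF S (A z) := by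
    intro z
    have hu : IsUnit R.det := isUnit_iff_ne_zero.mpr hd
    have hq : (R *ᵥ z.ofLp) ⬝ᵥ (S⁻¹ *ᵥ (R *ᵥ z.ofLp)) = z.ofLp ⬝ᵥ z.ofLp := by
      rw [← hRR, Matrix.mul_inv_rev, Matrix.mulVec_mulVec, Matrix.mul_assoc,
        Matrix.nonsing_inv_mul _ hu, Matrix.mul_one, Matrix.dotProduct_mulVec,
        ← Matrix.vecMul_transpose, hRs, Matrix.vecMul_vecMul, Matrix.mul_nonsing_inv _ hu,
        Matrix.vecMul_one]
    unfold normalPDF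
    rw [hAv, hq, ← hd2, Real.sqrt_mul (by positivity) (R.det * R.det),
      Real.sqrt_mul_self_eq_abs]
    have : |R.det| ≠ 0 := abs_ne_zero.mpr hd
    simp only [Matrix.det_one, mul_one, inv_one, Matrix.one_mulVec, mul_inv]
    field_simp
  have hm : Measurable (normalPDF S) := (continuous_normalPDF S).measurable
  unfold multivariateGaussian
  simp only [zero_add]
  rw [stdGaussian_eq_densMeasure]
  ext s hs
  change Measure.map A _ s = _
  rw [Measure.map_apply A.measurable hs, densMeasure, densMeasure,
    withDensity_apply _ (A.measurable hs), withDensity_apply _ hs]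
  simp_rw [hval, ENNReal.ofReal_mul (abs_nonneg _)]
  rw [← setLIntegral_map (μ := volume)
    (f := fun x => ENNReal.ofReal |R.det| * ENNReal.ofReal (normalPDF S x)) hs (by fun_prop)
    A.measurable]
  change ∫⁻ y in s, _ ∂(Measure.map (A : Vec d →ₗ[ℝ] Vec d) volume) = _
  rw [hmap, Measure.restrict_smul, lintegral_smul_measure, lintegral_const_mul _ (by fun_prop),
    smul_eq_mul, ← mul_assoc, ← ENNReal.ofReal_mul (abs_nonneg _), ← abs_mul,
    inv_mul_cancel₀ hd, abs_one, ENNReal.ofReal_one, one_mul]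

/-- `mmnPDF a S L θ` is a Lebesgue density of `MMN_d(θ, a, S, L)`. -/
theorem densMeasure_mmnPDF {d : ℕ} (θ a : Vec d) {S : Matrix (Fin d) (Fin d) ℝ}
    (hS : S.PosDef) (L : Measure ℝ) [IsProbabilityMeasure L] :
    densMeasure (mmnPDF a S L θ) = mmnLaw θ a S L := by
  have hc := continuous_normalPDF S
  have hm : Measurable (normalPDF S) := hc.measurable
  have hb : ∀ z, normalPDF S z ≤ (Real.sqrt ((2 * Real.pi) ^ d * S.det))⁻¹ := by
    intro z
    unfold normalPDF
    apply mul_le_of_le_one_right (by positivity)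
    rw [Real.exp_le_one_iff]
    have := hS.inv.posSemidef.dotProduct_mulVec_nonneg z.ofLp
    simp only [star_trivial] at this
    linarith
  have hi : ∀ x, Integrable (fun v => normalPDF S (x - θ - v • a)) L := by
    intro x
    refine Integrable.of_bound (by fun_prop) (Real.sqrt ((2 * Real.pi) ^ d * S.det))⁻¹
      (Filter.Eventually.of_forall fun v => ?_)
    rw [Real.norm_of_nonneg (normalPDF_nonneg _ _)]
    exact hb _
  ext s hs
  unfold mmnLaw
  rw [Measure.map_apply (by fun_prop) hs, Measure.prod_apply (by measurability), densMeasure,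
    withDensity_apply _ hs]
  have h1 : ∀ x, ENNReal.ofReal (mmnPDF a S L θ x) =
      ∫⁻ v, ENNReal.ofReal (normalPDF S (x - θ - v • a)) ∂L := fun x =>
    ofReal_integral_eq_lintegral_ofReal (hi x)
      (Filter.Eventually.of_forall fun v => normalPDF_nonneg _ _)
  simp_rw [h1]
  rw [lintegral_lintegral_swap (by fun_prop)]
  congr 1; ext v
  have hmv : Measurable fun z : Vec d => θ + v • a + z := by fun_prop
  rw [multivariateGaussian_eq_densMeasure hS, densMeasure]
  change _ = (volume.withDensity _) ((fun z : Vec d => θ + v • a + z) ⁻¹' s)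
  rw [withDensity_apply _ (hmv hs)]
  have h2 := setLIntegral_map (μ := (volume : Measure (Vec d))) hs
    (f := fun x => ENNReal.ofReal (normalPDF S (x - θ - v • a))) (by fun_prop) hmv
  rw [map_add_left_eq_self] at h2
  rw [h2]
  congr 1; ext z
  congr 2; abel

end

/-! Optimality holds in any location model with densities `p₀ (x - θ)` and `q₀ (y - θ)`, `q₀`
bounded; normality matters only for the closed form. Let `t = x - θ` be the estimation error, with
law `P` of density `p₀`. Under the flat prior the posterior of `t` is `P` whatever `x` is, so the
predictive density is the `P`-mixture of the shifts `q₀ (y - x + t)`.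

MRE: an equivariant estimator amounts to a single density `g = qhat 0`, and its risk is, at every
`θ`, the `P`-average of the divergence from `q₀ (· + t)` to `g`. By the compensation inequality
`lintegral_klDens_add_le` the mixture minimises this average, and the excess of `g` is at least the
divergence from the mixture to `g`. This gives optimality and, when the minimum is finite,
uniqueness.

Minimaxity: bound the maximal risk from below by averaging over `θ` in a ball of radius `N`. If `x`
lies in the ball of radius `N - r`, every error with `‖t‖ < r` comes from such a `θ`, and the volume
lost is negligible as `N → ∞` (`le_add_of_forall_lintegral_le`). For errors restricted to a set `B`,
the mixture over `P` conditioned on `B` beats any competitor, and the flat mixture loses at most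
`log (1 / P B)` against it (`setLIntegral_klDens_flatPredictive_le`). Letting `r → ∞` removes this
loss. Infinite risks are allowed throughout.

Closed form: by Fubini, fix the two mixing variables; what remains is a convolution of normals whose
shifts combine to `(v₂ - v₁) a`. -/

/-! ### The pointwise Kullback-Leibler integrand -/

/-- The integrand `s log (s / t) + t - s` of the Kullback-Leibler divergence between densities. -/
noncomputable def klIntegrand (s t : ℝ) : ℝ≥0∞ :=
  -- The case `t = 0` is separate because Lean's `s / 0 = 0` would make the general formula vanish,
  -- where positive `s` must cost `∞`.
  if t = 0 then (if s = 0 then 0 else ∞) else ENNReal.ofReal (t * klFun (s / t))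

lemma measurable_klIntegrand : Measurable fun w : ℝ × ℝ => klIntegrand w.1 w.2 := by
  unfold klIntegrand
  have h := measurable_klFun
  refine Measurable.ite (measurableSet_eq_fun measurable_snd measurable_const) ?_ (by fun_prop)
  exact Measurable.ite (measurableSet_eq_fun measurable_fst measurable_const) measurable_const
    measurable_const

@[fun_prop]
lemma Measurable.klIntegrand {α : Type*} [MeasurableSpace α] {f g : α → ℝ} (hf : Measurable f)
    (hg : Measurable g) : Measurable fun x => klIntegrand (f x) (g x) :=
  measurable_klIntegrand.comp (hf.prodMk hg)

lemma klIntegrand_zero_zero : klIntegrand 0 0 = 0 := by simp [klIntegrand]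

lemma klIntegrand_zero_left {t : ℝ} : klIntegrand 0 t = ENNReal.ofReal t := by
  by_cases h : t = 0 <;> simp [klIntegrand, h, klFun_zero]

lemma klIntegrand_zero_right {s : ℝ} (hs : s ≠ 0) : klIntegrand s 0 = ∞ := by
  simp [klIntegrand, hs]

lemma klIntegrand_of_ne {s t : ℝ} (ht : t ≠ 0) :
    klIntegrand s t = ENNReal.ofReal (t * klFun (s / t)) := by
  simp [klIntegrand, ht]

lemma mul_klFun_div {s t : ℝ} (ht : t ≠ 0) :
    t * klFun (s / t) = s * (Real.log s - Real.log t) + t - s := by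
  rcases eq_or_ne s 0 with rfl | hs
  · simp [klFun_zero]
  · rw [klFun_apply, Real.log_div hs ht]; field_simp

lemma mul_klFun_div_nonneg {s t : ℝ} (hs : 0 ≤ s) (ht : 0 ≤ t) : 0 ≤ t * klFun (s / t) :=
  mul_nonneg ht (klFun_nonneg (div_nonneg hs ht))

/-! ### Divergence between densities and the compensation inequality. -/

section locationModels

variable {d : ℕ}

/-- `f` is a probability density on `ℝ^d`. -/
structure IsProbDensity (f : Vec d → ℝ) : Prop where
  measurable : Measurable f
  nonneg : ∀ y, 0 ≤ f y
  lintegral_eq_one : ∫⁻ y, ENNReal.ofReal (f y) = 1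

lemma IsProbDensity.isProbabilityMeasure {f : Vec d → ℝ} (hf : IsProbDensity f) :
    IsProbabilityMeasure (densMeasure f) :=
  ⟨by rw [densMeasure, withDensity_apply _ .univ, Measure.restrict_univ, hf.lintegral_eq_one]⟩

lemma IsPredictiveDensity.isProbDensity {qhat : Vec d → Vec d → ℝ} (h : IsPredictiveDensity qhat)
    (x : Vec d) : IsProbDensity (qhat x) :=
  ⟨h.measurable.comp measurable_prodMk_left, h.nonneg x, h.lintegral_eq_one x⟩

lemma densMeasure_absolutelyContinuous_iff {f g : Vec d → ℝ} (hf : Measurable f)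
    (hg : Measurable g) (hf0 : ∀ y, 0 ≤ f y) (hg0 : ∀ y, 0 ≤ g y) :
    densMeasure f ≪ densMeasure g ↔ ∀ᵐ y, g y = 0 → f y = 0 := by
  constructor
  · intro h
    have hs : MeasurableSet {y | g y = 0} := measurableSet_eq_fun hg measurable_const
    have h0 : densMeasure g {y | g y = 0} = 0 := by
      rw [densMeasure, withDensity_apply _ hs, setLIntegral_congr_fun hs (g := fun _ => 0)
        (fun y hy => by simp [show g y = 0 from hy])]
      simp
    have h1 := h h0
    rw [densMeasure, withDensity_apply _ hs, lintegral_eq_zero_iff (by fun_prop)] at h1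
    filter_upwards [(ae_restrict_iff' hs).mp h1] with y hy hgy
    exact le_antisymm (by simpa using hy hgy) (hf0 y)
  · intro h s hs
    rw [densMeasure, withDensity_apply_eq_zero' (by fun_prop)] at hs ⊢
    refine measure_mono_null_ae ?_ hs
    filter_upwards [h] with y hy hys
    refine ⟨?_, hys.2⟩
    have h1 : 0 < f y := by simpa using hys.1
    have : g y ≠ 0 := fun h0 => h1.ne' (hy h0)
    simpa using lt_of_le_of_ne (hg0 y) this.symm

/-- Under absolute continuity the Radon-Nikodym derivative is `f / g`; otherwise `f ≠ 0 = g` on a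
non-null set, where the integrand is `∞`. The integrand being nonnegative, Tonelli applies to
averaged divergences without integrability conditions. -/
lemma klDens_eq_lintegral {f g : Vec d → ℝ} (hf' : IsProbDensity f) (hg' : IsProbDensity g) :
    klDens f g = ∫⁻ y, klIntegrand (f y) (g y) := by
  obtain ⟨hf, hf0, -⟩ := id hf'
  obtain ⟨hg, hg0, -⟩ := id hg'
  have := hf'.isProbabilityMeasure
  have := hg'.isProbabilityMeasure
  have hac := densMeasure_absolutelyContinuous_iff hf hg hf0 hg0
  by_cases h : ∀ᵐ y, g y = 0 → f y = 0
  · have hfg : densMeasure f = (densMeasure g).withDensity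
        (fun y => ENNReal.ofReal (f y / g y)) := by
      unfold densMeasure
      rw [← withDensity_mul _ (by fun_prop) (by fun_prop)]
      refine withDensity_congr_ae ?_
      filter_upwards [h] with y hy
      simp only [Pi.mul_apply]
      rw [← ENNReal.ofReal_mul (hg0 y)]
      by_cases hgy : g y = 0
      · simp [hgy, hy hgy]
      · rw [mul_div_cancel₀ _ hgy]
    have hr : (densMeasure f).rnDeriv (densMeasure g) =ᵐ[densMeasure g]
        fun y => ENNReal.ofReal (f y / g y) := by
      nth_rw 1 [hfg]
      exact Measure.rnDeriv_withDensity _ (by fun_prop)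
    rw [klDens, klDiv_eq_lintegral_klFun_of_ac (hac.mpr h)]
    have hk := measurable_klFun
    rw [lintegral_congr_ae (g := fun y => ENNReal.ofReal (klFun (f y / g y)))
      (by filter_upwards [hr] with y hy
          rw [hy, ENNReal.toReal_ofReal (div_nonneg (hf0 y) (hg0 y))]), densMeasure,
      lintegral_withDensity_eq_lintegral_mul _ (by fun_prop) (by fun_prop)]
    refine lintegral_congr_ae ?_
    filter_upwards [h] with y hy
    simp only [Pi.mul_apply]
    rw [← ENNReal.ofReal_mul (hg0 y)]
    by_cases hgy : g y = 0
    · simp [hgy, hy hgy, klIntegrand_zero_zero]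
    · rw [klIntegrand_of_ne hgy]
  · rw [klDens, klDiv_of_not_ac (fun h' => h (hac.mp h'))]
    symm
    by_contra hne
    refine h ?_
    filter_upwards [ae_lt_top (hf.klIntegrand hg) hne] with y hy hgy
    by_contra hfy
    rw [hgy, klIntegrand_zero_right hfy] at hy
    exact lt_irrefl _ hy

/-- Monotonicity of the logarithm gives `log t ≥ log u + log c`. The linear terms `c` and `t` are
placed on opposite sides to avoid subtraction in `ℝ≥0∞`; they cancel after integration. -/
lemma klIntegrand_le_add_log {s c t u : ℝ} (hs : 0 ≤ s) (hc : 0 ≤ c) (hu : 0 < u) (hu1 : u ≤ 1)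
    (h : u * c ≤ t) :
    klIntegrand s t + ENNReal.ofReal c ≤
      klIntegrand s c + ENNReal.ofReal (Real.log u⁻¹) * ENNReal.ofReal s + ENNReal.ofReal t := by
  have ht : 0 ≤ t := (mul_nonneg hu.le hc).trans h
  have hl : 0 ≤ Real.log u⁻¹ := Real.log_nonneg ((one_le_inv₀ hu).mpr hu1)
  rcases hc.eq_or_lt with rfl | hc
  · rcases hs.eq_or_lt with rfl | hs
    · simp [klIntegrand_zero_left]
    · simp [klIntegrand_zero_right hs.ne']
  · have ht : 0 < t := (mul_pos hu hc).trans_le h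
    rw [klIntegrand_of_ne ht.ne', klIntegrand_of_ne hc.ne', ← ENNReal.ofReal_mul hl,
      ← ENNReal.ofReal_add (mul_klFun_div_nonneg hs ht.le) hc.le,
      ← ENNReal.ofReal_add (mul_klFun_div_nonneg hs hc.le) (by positivity),
      ← ENNReal.ofReal_add (add_nonneg (mul_klFun_div_nonneg hs hc.le) (by positivity)) ht.le]
    apply ENNReal.ofReal_le_ofReal
    rw [mul_klFun_div ht.ne', mul_klFun_div hc.ne', Real.log_inv]
    have := Real.log_le_log (mul_pos hu hc) h
    rw [Real.log_mul hu.ne' hc.ne'] at this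
    nlinarith

/-- If `u c ≤ t` for densities `c`, `t`, then replacing `c` by `t` increases the divergence by at
most `log (1 / u)`. -/
lemma klDens_le_add_log {f c t : Vec d → ℝ} {u : ℝ} (hf : IsProbDensity f) (hc : IsProbDensity c)
    (ht : IsProbDensity t) (hu : 0 < u) (hu1 : u ≤ 1) (h : ∀ y, u * c y ≤ t y) :
    klDens f t ≤ klDens f c + ENNReal.ofReal (Real.log u⁻¹) := by
  have mf := hf.measurable
  have mc := hc.measurable
  have mt := ht.measurable
  have hi := lintegral_mono (μ := volume)
    fun y => klIntegrand_le_add_log (hf.nonneg y) (hc.nonneg y) hu hu1 (h y)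
  rw [lintegral_add_right _ (by fun_prop), lintegral_add_right _ (by fun_prop),
    lintegral_add_right _ (by fun_prop), lintegral_const_mul _ (by fun_prop), hf.lintegral_eq_one,
    hc.lintegral_eq_one, ht.lintegral_eq_one, mul_one, ← klDens_eq_lintegral hf ht,
    ← klDens_eq_lintegral hf hc] at hi
  exact (ENNReal.add_le_add_iff_right ENNReal.one_ne_top).mp hi

/-- The compensation inequality for the Kullback-Leibler integrand. -/
lemma lintegral_klIntegrand_add_le {Θ : Type*} [MeasurableSpace Θ] (μ : Measure Θ)
    [IsProbabilityMeasure μ] {s : Θ → ℝ} (hs : Measurable s) (hs0 : ∀ θ, 0 ≤ s θ)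
    (hsi : Integrable s μ) {g : ℝ} (hg : 0 ≤ g) :
    ∫⁻ θ, klIntegrand (s θ) (∫ θ, s θ ∂μ) ∂μ + klIntegrand (∫ θ, s θ ∂μ) g ≤
      ∫⁻ θ, klIntegrand (s θ) g ∂μ := by
  set c := ∫ θ, s θ ∂μ with hc
  have hc0 : 0 ≤ c := integral_nonneg hs0
  rcases hc0.eq_or_lt with h0 | hcpos
  -- Mean zero forces `s = 0` almost everywhere, and each term becomes explicit.
  · have hz : s =ᵐ[μ] 0 := (integral_eq_zero_iff_of_nonneg hs0 hsi).mp (hc ▸ h0.symm)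
    have e : ∀ t, ∫⁻ θ, klIntegrand (s θ) t ∂μ = ENNReal.ofReal t := fun t => by
      rw [lintegral_congr_ae (g := fun _ => ENNReal.ofReal t)
        (by filter_upwards [hz] with θ hθ; rw [hθ, Pi.zero_apply, klIntegrand_zero_left])]
      simp
    rw [e, e, ← h0, klIntegrand_zero_left]; simp
  rcases hg.eq_or_lt with rfl | hgpos
  -- Since the mean is positive, `s` is nonzero on a non-null set, so the right side is infinite.
  · have : ∫⁻ θ, klIntegrand (s θ) 0 ∂μ = ∞ := by
      by_contra hne
      have hz : s =ᵐ[μ] 0 := by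
        filter_upwards [ae_lt_top (by fun_prop) hne] with θ hθ
        by_contra hθ0
        rw [klIntegrand_zero_right hθ0] at hθ
        exact lt_irrefl _ hθ
      rw [integral_congr_ae hz] at hc
      simp at hc
      exact hcpos.ne' hc
    simp [this]
  · by_cases hfin : ∫⁻ θ, klIntegrand (s θ) g ∂μ = ∞
    · simp [hfin]
    have hk := measurable_klFun
    have hgi : Integrable (fun θ => g * klFun (s θ / g)) μ := by
      rw [← lintegral_ofReal_ne_top_iff_integrable (by fun_prop)
        (Filter.Eventually.of_forall fun θ => mul_klFun_div_nonneg (hs0 θ) hg)]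
      simpa only [klIntegrand_of_ne hgpos.ne'] using hfin
    -- The two integrands differ by an affine function of `s`, whose mean is `-g * klFun (c / g)`.
    -- So integrability transfers, and the inequality is in fact an equality here.
    have e : (fun θ => c * klFun (s θ / c)) =
        fun θ => g * klFun (s θ / g) + (s θ * (Real.log g - Real.log c) + (c - g)) := by
      ext θ
      rw [mul_klFun_div hgpos.ne', mul_klFun_div hcpos.ne']; ring
    have hi2 : Integrable (fun θ => s θ * (Real.log g - Real.log c) + (c - g)) μ :=
      (hsi.mul_const _).add (integrable_const _)
    have hci : Integrable (fun θ => c * klFun (s θ / c)) μ := by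
      rw [e]; exact hgi.add hi2
    simp only [klIntegrand_of_ne hgpos.ne', klIntegrand_of_ne hcpos.ne']
    rw [← ofReal_integral_eq_lintegral_ofReal hgi
        (Filter.Eventually.of_forall fun θ => mul_klFun_div_nonneg (hs0 θ) hg),
      ← ofReal_integral_eq_lintegral_ofReal hci
        (Filter.Eventually.of_forall fun θ => mul_klFun_div_nonneg (hs0 θ) hc0),
      ← ENNReal.ofReal_add (integral_nonneg fun θ => mul_klFun_div_nonneg (hs0 θ) hc0)
        (mul_klFun_div_nonneg hc0 hg)]
    apply ENNReal.ofReal_le_ofReal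
    rw [e, integral_add hgi hi2, integral_add (hsi.mul_const _) (integrable_const _),
      integral_mul_const, ← hc, mul_klFun_div hgpos.ne']
    simp
    linarith

/-- A mixture of probability densities is a probability density. -/
lemma isProbDensity_integral {Θ : Type*} [MeasurableSpace Θ] (μ : Measure Θ)
    [IsProbabilityMeasure μ] {s : Θ → Vec d → ℝ} (hs : Measurable fun w : Θ × Vec d => s w.1 w.2)
    (hsd : ∀ θ, IsProbDensity (s θ)) (hsi : ∀ y, Integrable (fun θ => s θ y) μ) :
    IsProbDensity fun y => ∫ θ, s θ y ∂μ where
  measurable := (StronglyMeasurable.integral_prod_left' (f := fun w : Θ × Vec d => s w.1 w.2)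
    hs.stronglyMeasurable).measurable
  nonneg y := integral_nonneg fun θ => (hsd θ).nonneg y
  lintegral_eq_one := by
    simp_rw [fun y => ofReal_integral_eq_lintegral_ofReal (hsi y)
      (Filter.Eventually.of_forall fun θ => (hsd θ).nonneg y)]
    rw [lintegral_lintegral_swap (by
      exact (hs.comp measurable_swap).ennreal_ofReal.aemeasurable)]
    simp [fun θ => (hsd θ).lintegral_eq_one]

/-- The compensation inequality: among all densities, the mixture minimises the average
Kullback-Leibler divergence, with an excess at least the divergence from the mixture. -/
lemma lintegral_klDens_add_le {Θ : Type*} [MeasurableSpace Θ] (μ : Measure Θ)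
    [IsProbabilityMeasure μ] {s : Θ → Vec d → ℝ} (hs : Measurable fun w : Θ × Vec d => s w.1 w.2)
    (hsd : ∀ θ, IsProbDensity (s θ)) (hsi : ∀ y, Integrable (fun θ => s θ y) μ) {g : Vec d → ℝ}
    (hg : IsProbDensity g) :
    ∫⁻ θ, klDens (s θ) (fun y => ∫ θ, s θ y ∂μ) ∂μ + klDens (fun y => ∫ θ, s θ y ∂μ) g ≤
      ∫⁻ θ, klDens (s θ) g ∂μ := by
  have hsy : ∀ y, Measurable fun θ => s θ y := fun y => hs.comp measurable_prodMk_right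
  have hm := isProbDensity_integral μ hs hsd hsi
  have mm := hm.measurable
  have mg := hg.measurable
  simp_rw [fun θ => klDens_eq_lintegral (hsd θ) hm, fun θ => klDens_eq_lintegral (hsd θ) hg]
  rw [klDens_eq_lintegral hm hg,
    lintegral_lintegral_swap (f := fun θ y => klIntegrand (s θ y) (∫ θ, s θ y ∂μ))
      (hs.klIntegrand (mm.comp measurable_snd)).aemeasurable,
    lintegral_lintegral_swap (f := fun θ y => klIntegrand (s θ y) (g y))
      (hs.klIntegrand (mg.comp measurable_snd)).aemeasurable,
    ← lintegral_add_right _ (by fun_prop)]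
  exact lintegral_mono fun y => lintegral_klIntegrand_add_le μ (hsy y)
    (fun θ => (hsd θ).nonneg y) (hsi y) (hg.nonneg y)

/-! ### Location models -/

lemma IsProbDensity.comp_add_right {f : Vec d → ℝ} (hf : IsProbDensity f) (c : Vec d) :
    IsProbDensity fun y => f (y + c) where
  measurable := hf.measurable.comp (measurable_add_const c)
  nonneg y := hf.nonneg _
  lintegral_eq_one := by
    rw [lintegral_add_right_eq_self fun y => ENNReal.ofReal (f y)]
    exact hf.lintegral_eq_one

lemma IsProbDensity.comp_sub_right {f : Vec d → ℝ} (hf : IsProbDensity f) (c : Vec d) :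
    IsProbDensity fun y => f (y - c) := by
  simpa only [sub_eq_add_neg] using hf.comp_add_right (-c)

lemma IsProbDensity.integral_eq_one {f : Vec d → ℝ} (hf : IsProbDensity f) : ∫ y, f y = 1 := by
  rw [integral_eq_lintegral_of_nonneg_ae (Filter.Eventually.of_forall hf.nonneg)
    hf.measurable.aestronglyMeasurable, hf.lintegral_eq_one, ENNReal.toReal_one]

lemma integral_densMeasure {f : Vec d → ℝ} (hf : IsProbDensity f) (g : Vec d → ℝ) :
    ∫ t, g t ∂densMeasure f = ∫ t, g t * f t := by
  have := hf.measurable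
  rw [densMeasure, integral_withDensity_eq_integral_toReal_smul (by fun_prop) (by simp)]
  simp [ENNReal.toReal_ofReal (hf.nonneg _), mul_comm]

lemma klDens_comp_add_right {f g : Vec d → ℝ} (hf : IsProbDensity f) (hg : IsProbDensity g)
    (c : Vec d) : klDens (fun y => f (y + c)) (fun y => g (y + c)) = klDens f g := by
  rw [klDens_eq_lintegral (hf.comp_add_right c) (hg.comp_add_right c), klDens_eq_lintegral hf hg,
    lintegral_add_right_eq_self fun y => klIntegrand (f y) (g y)]

lemma klDens_congr_right {f g g' : Vec d → ℝ} (h : g =ᵐ[volume] g') :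
    klDens f g = klDens f g' := by
  have : densMeasure g = densMeasure g' :=
    withDensity_congr_ae (by filter_upwards [h] with y hy; rw [hy])
  rw [klDens, klDens, this]

lemma ae_eq_of_klDens_eq_zero {f g : Vec d → ℝ} (hf : IsProbDensity f) (hg : IsProbDensity g)
    (h : klDens f g = 0) : f =ᵐ[volume] g := by
  have := hf.isProbabilityMeasure
  have := hg.isProbabilityMeasure
  have mf := hf.measurable
  have mg := hg.measurable
  have h1 : densMeasure f = densMeasure g := klDiv_eq_zero_iff.mp h
  filter_upwards [(withDensity_eq_iff (by fun_prop) (by fun_prop)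
    (by rw [hf.lintegral_eq_one]; simp)).mp h1] with y hy
  exact (ENNReal.ofReal_eq_ofReal_iff (hf.nonneg y) (hg.nonneg y)).mp hy

/-- The Bayes predictive density for the flat prior in the location model with densities
`x ↦ p₀ (x - θ)` and `y ↦ q₀ (y - θ)`, as a mixture over the estimation error `t = x - θ`. -/
noncomputable def flatPredictive (p₀ q₀ : Vec d → ℝ) (x y : Vec d) : ℝ :=
  ∫ t, q₀ (y - x + t) ∂densMeasure p₀

/-- Substitute `t = x - θ`: Lebesgue measure is invariant under this reflection. -/
lemma integral_mul_eq_flatPredictive {p₀ : Vec d → ℝ} (hp : IsProbDensity p₀) (q₀ : Vec d → ℝ)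
    (x y : Vec d) : ∫ θ, q₀ (y - θ) * p₀ (x - θ) = flatPredictive p₀ q₀ x y := by
  rw [flatPredictive, integral_densMeasure hp,
    ← integral_sub_left_eq_self (fun t => q₀ (y - x + t) * p₀ t) volume x]
  congr 1; ext θ
  congr 2; abel

lemma klRisk_location (p₀ : Vec d → ℝ) (q qhat : Vec d → Vec d → ℝ)
    (θ : Vec d) : klRisk (fun θ x => p₀ (x - θ)) q θ qhat =
      ∫⁻ t, klDens (q θ) (qhat (θ + t)) ∂densMeasure p₀ := by
  have h : densMeasure (fun x => p₀ (x - θ)) = (densMeasure p₀).map (MeasurableEquiv.addLeft θ) := by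
    ext s hs
    rw [Measure.map_apply (MeasurableEquiv.measurable _) hs, densMeasure, densMeasure,
      withDensity_apply _ hs, withDensity_apply _ (MeasurableEquiv.measurable _ hs)]
    rw [← lintegral_indicator hs, ← lintegral_indicator (MeasurableEquiv.measurable _ hs),
      ← lintegral_add_left_eq_self _ θ]
    congr 1; ext t
    simp [Set.indicator]
    rfl
  rw [klRisk, h, lintegral_map_equiv]
  rfl

section

variable {p₀ q₀ : Vec d → ℝ}

/-- The shift `c = -x` carries the observation to the origin, so one density determines the
estimator up to null sets. -/
lemma IsLocationEquivariant.ae_eq {qhat : Vec d → Vec d → ℝ} (he : IsLocationEquivariant qhat)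
    (x : Vec d) : qhat x =ᵐ[volume] fun y => qhat 0 (y - x) := by
  have h := he (-x) x
  filter_upwards [h] with y hy
  rw [← hy, add_neg_cancel, sub_eq_add_neg]

/-- Shifting `y` by `θ + t` leaves the divergence unchanged and removes `θ`: the risk is constant,
and the choice of estimator becomes the choice of one density. -/
lemma klRisk_location_of_equivariant (hq : IsProbDensity q₀)
    {qhat : Vec d → Vec d → ℝ} (hd : IsPredictiveDensity qhat) (he : IsLocationEquivariant qhat)
    (θ : Vec d) : klRisk (fun θ x => p₀ (x - θ)) (fun θ y => q₀ (y - θ)) θ qhat =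
      ∫⁻ t, klDens (fun y => q₀ (y + t)) (qhat 0) ∂densMeasure p₀ := by
  rw [klRisk_location]
  congr 1; ext t
  rw [klDens_congr_right (he.ae_eq (θ + t)),
    ← klDens_comp_add_right (hq.comp_sub_right θ) ((hd.isProbDensity 0).comp_sub_right _) (θ + t)]
  congr 1 <;> ext y
  · congr 1; abel
  · simp

lemma integrable_comp_of_le (μ : Measure (Vec d)) [IsFiniteMeasure μ] (hq : IsProbDensity q₀)
    {C : ℝ} (hC : ∀ y, q₀ y ≤ C) (y : Vec d) : Integrable (fun t => q₀ (y + t)) μ := by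
  have := hq.measurable
  refine Integrable.of_bound (Measurable.aestronglyMeasurable (by fun_prop)) C
    (Filter.Eventually.of_forall fun t => ?_)
  rw [Real.norm_of_nonneg (hq.nonneg _)]
  exact hC _

lemma isPredictiveDensity_flatPredictive (hp : IsProbDensity p₀) (hq : IsProbDensity q₀)
    {C : ℝ} (hC : ∀ y, q₀ y ≤ C) : IsPredictiveDensity (flatPredictive p₀ q₀) := by
  have := hp.isProbabilityMeasure
  have mq := hq.measurable
  have h (x : Vec d) : IsProbDensity (flatPredictive p₀ q₀ x) := by
    refine isProbDensity_integral (densMeasure p₀) (s := fun t y => q₀ (y - x + t)) (by fun_prop)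
      (fun t => ?_) fun y => integrable_comp_of_le _ hq hC _
    simpa only [sub_add] using hq.comp_sub_right (x - t)
  refine ⟨?_, fun x => (h x).nonneg, fun x => (h x).lintegral_eq_one⟩
  exact (StronglyMeasurable.integral_prod_left' (μ := densMeasure p₀)
    (f := fun w : Vec d × (Vec d × Vec d) => q₀ (w.2.2 - w.2.1 + w.1))
    (Measurable.stronglyMeasurable (by fun_prop))).measurable

lemma isLocationEquivariant_flatPredictive : IsLocationEquivariant (flatPredictive p₀ q₀) :=
  fun c x => Filter.Eventually.of_forall fun y => by simp [flatPredictive]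

/-- This is the compensation inequality at observation `0`. Keeping the excess term gives uniqueness
as well as optimality. -/
lemma klRisk_flatPredictive_add_le (hp : IsProbDensity p₀) (hq : IsProbDensity q₀)
    {C : ℝ} (hC : ∀ y, q₀ y ≤ C) {qhat : Vec d → Vec d → ℝ} (hd : IsPredictiveDensity qhat)
    (he : IsLocationEquivariant qhat) (θ : Vec d) :
    klRisk (fun θ x => p₀ (x - θ)) (fun θ y => q₀ (y - θ)) θ (flatPredictive p₀ q₀) +
        klDens (flatPredictive p₀ q₀ 0) (qhat 0) ≤
      klRisk (fun θ x => p₀ (x - θ)) (fun θ y => q₀ (y - θ)) θ qhat := by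
  have := hp.isProbabilityMeasure
  have mq := hq.measurable
  rw [klRisk_location_of_equivariant hq hd he, klRisk_location_of_equivariant hq
    (isPredictiveDensity_flatPredictive hp hq hC) isLocationEquivariant_flatPredictive]
  have e : flatPredictive p₀ q₀ 0 = fun y => ∫ t, q₀ (y + t) ∂densMeasure p₀ := by
    ext y; simp [flatPredictive]
  rw [e]
  exact lintegral_klDens_add_le (densMeasure p₀) (s := fun t y => q₀ (y + t)) (by fun_prop)
    (fun t => hq.comp_add_right t) (fun y => integrable_comp_of_le _ hq hC y) (hd.isProbDensity 0)

/-- In a location model the flat-prior predictive density is minimum risk equivariant. -/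
lemma isMRE_flatPredictive (hp : IsProbDensity p₀) (hq : IsProbDensity q₀)
    {C : ℝ} (hC : ∀ y, q₀ y ≤ C) :
    IsMRE (fun θ x => p₀ (x - θ)) (fun θ y => q₀ (y - θ)) (flatPredictive p₀ q₀) where
  isPredictiveDensity := isPredictiveDensity_flatPredictive hp hq hC
  equivariant := isLocationEquivariant_flatPredictive
  minimum_risk _ hd he θ := le_self_add.trans (klRisk_flatPredictive_add_le hp hq hC hd he θ)

/-- A minimum risk equivariant predictive density is unique if its risk is finite. -/
lemma IsMRE.ae_eq_flatPredictive (hp : IsProbDensity p₀) (hq : IsProbDensity q₀)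
    {C : ℝ} (hC : ∀ y, q₀ y ≤ C) {θ : Vec d}
    (hfin : klRisk (fun θ x => p₀ (x - θ)) (fun θ y => q₀ (y - θ)) θ (flatPredictive p₀ q₀) ≠ ∞)
    {qhat : Vec d → Vec d → ℝ}
    (h : IsMRE (fun θ x => p₀ (x - θ)) (fun θ y => q₀ (y - θ)) qhat) (x : Vec d) :
    qhat x =ᵐ[volume] flatPredictive p₀ q₀ x := by
  have hU := isMRE_flatPredictive hp hq hC
  have h1 := (klRisk_flatPredictive_add_le hp hq hC h.isPredictiveDensity h.equivariant θ).trans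
    (h.minimum_risk _ hU.isPredictiveDensity hU.equivariant θ)
  have h0 : klDens (flatPredictive p₀ q₀ 0) (qhat 0) = 0 := by
    have := ENNReal.le_sub_of_add_le_left hfin h1
    simpa using this
  have h2 := ae_eq_of_klDens_eq_zero (hU.isPredictiveDensity.isProbDensity 0)
    (h.isPredictiveDensity.isProbDensity 0) h0
  have h3 := (measurePreserving_sub_right volume x).quasiMeasurePreserving.ae h2
  filter_upwards [h.equivariant.ae_eq x, hU.equivariant.ae_eq x, h3] with y e1 e2 e3
  rw [e1, e2, e3]

end

/-! ### Minimaxity -/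

/-- Averaging over large balls: a lower bound for `K`, uniform in the observation `x`, is a lower
bound for its supremum over the parameter `θ = x - t`. -/
lemma le_add_of_forall_lintegral_le (P : Measure (Vec d)) [SFinite P]
    {K : Vec d → Vec d → ℝ≥0∞} (hK : Measurable fun w : Vec d × Vec d => K w.1 w.2) {M A ε : ℝ≥0∞}
    (hM : ∀ θ, ∫⁻ t, K (θ + t) t ∂P ≤ M) {r : ℝ} (hr : 0 ≤ r)
    (hA : ∀ x, A ≤ ∫⁻ t in Metric.ball 0 r, K x t ∂P + ε) : A ≤ M + ε := by
  set B : ℝ → Set (Vec d) := fun s => Metric.ball 0 s with hB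
  have hBm : ∀ s, MeasurableSet (B s) := fun s => measurableSet_ball
  -- If `‖x‖ < N - r` and `‖t‖ < r`, then `θ = x - t` satisfies `‖θ‖ < N`. Integrating the lower
  -- bound over `x` and changing variables to `θ` therefore meets only parameters in `B N`.
  have key : ∀ N, volume (B (N - r)) * A ≤ volume (B N) * M + volume (B (N - r)) * ε := by
    intro N
    calc volume (B (N - r)) * A = ∫⁻ _ in B (N - r), A := by simp [mul_comm]
      _ ≤ ∫⁻ x in B (N - r), (∫⁻ t in B r, K x t ∂P + ε) := lintegral_mono fun x => hA x
      _ = (∫⁻ x in B (N - r), ∫⁻ t in B r, K x t ∂P) + volume (B (N - r)) * ε := by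
        rw [lintegral_add_right _ measurable_const]; simp [mul_comm]
      _ ≤ _ := by
        refine add_le_add ?_ le_rfl
        calc ∫⁻ x in B (N - r), ∫⁻ t in B r, K x t ∂P
            = ∫⁻ t in B r, ∫⁻ x in B (N - r), K x t ∂volume ∂P :=
              lintegral_lintegral_swap hK.aemeasurable
          _ ≤ ∫⁻ t in B r, ∫⁻ θ in B N, K (θ + t) t ∂volume ∂P := by
            refine setLIntegral_mono' (hBm r) fun t ht => ?_
            rw [← lintegral_indicator (hBm _), ← lintegral_indicator (hBm _),
              ← lintegral_add_right_eq_self _ t]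
            refine lintegral_mono fun θ => ?_
            by_cases h : θ + t ∈ B (N - r)
            · have hθ : θ ∈ B N := by
                simp only [hB, mem_ball_zero_iff] at h ht ⊢
                have := norm_sub_le (θ + t) t
                rw [add_sub_cancel_right] at this
                linarith
              simp [h, hθ]
            · simp [h]
          _ = ∫⁻ θ in B N, ∫⁻ t in B r, K (θ + t) t ∂P := by
            refine lintegral_lintegral_swap (f := fun t θ => K (θ + t) t) ?_
            exact (hK.comp ((measurable_snd.add measurable_fst).prodMk
              measurable_fst)).aemeasurable
          _ ≤ ∫⁻ _ in B N, M := lintegral_mono fun θ =>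
            (setLIntegral_le_lintegral _ _).trans (hM θ)
          _ = volume (B N) * M := by simp [mul_comm]
  have hv : ∀ s, 0 < s → volume (B s) = ENNReal.ofReal (s ^ d) * volume (B 1) := fun s hs => by
    simpa using Measure.addHaar_ball_of_pos (volume : Measure (Vec d)) 0 hs
  have ratio : ∀ᶠ N : ℝ in Filter.atTop,
      ENNReal.ofReal (((N - r) / N) ^ d) * A ≤ M + ε := by
    filter_upwards [Filter.eventually_gt_atTop (max 0 r)] with N hN
    have hN0 : 0 < N := (le_max_left _ _).trans_lt hN
    have hNr : 0 < N - r := sub_pos.mpr ((le_max_right _ _).trans_lt hN)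
    have h1 : volume (B (N - r)) * A ≤ volume (B N) * (M + ε) := by
      refine (key N).trans ?_
      rw [mul_add]
      gcongr
      exact Metric.ball_subset_ball (by linarith)
    have h2 : volume (B (N - r)) = volume (B N) * ENNReal.ofReal (((N - r) / N) ^ d) := by
      rw [hv _ hN0, hv _ hNr, mul_right_comm, ← ENNReal.ofReal_mul (by positivity),
        ← mul_pow, mul_div_cancel₀ _ hN0.ne']
    rw [h2, mul_assoc] at h1
    exact (ENNReal.mul_le_mul_iff_right (Metric.measure_ball_pos _ _ hN0).ne'
      measure_ball_lt_top.ne).mp h1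
  have lim : Filter.Tendsto (fun N : ℝ => ENNReal.ofReal (((N - r) / N) ^ d) * A) Filter.atTop
      (nhds A) := by
    have h1 : Filter.Tendsto (fun N : ℝ => ((N - r) / N) ^ d) Filter.atTop (nhds 1) := by
      have h2 : Filter.Tendsto (fun N : ℝ => 1 - r / N) Filter.atTop (nhds (1 - 0)) :=
        tendsto_const_nhds.sub (tendsto_const_nhds.div_atTop Filter.tendsto_id)
      rw [sub_zero] at h2
      have h3 := h2.pow d
      rw [one_pow] at h3
      refine h3.congr' ?_
      filter_upwards [Filter.eventually_gt_atTop 0] with N hN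
      rw [sub_div, div_self hN.ne']
    -- `A` may be `∞`; multiplication is still continuous there because the volume ratio tends to `1
    -- ≠ 0`.
    have h4 := ENNReal.Tendsto.mul_const (b := A) (ENNReal.tendsto_ofReal h1)
      (Or.inl (by simp))
    simpa using h4
  exact le_of_tendsto lim ratio

section

variable {p₀ q₀ : Vec d → ℝ}

/-- Comparison of the flat-prior predictive density with an arbitrary density `g`, when the
posterior of the estimation error is truncated to a set `B`. -/
lemma setLIntegral_klDens_flatPredictive_le (hp : IsProbDensity p₀) (hq : IsProbDensity q₀)
    {C : ℝ} (hC : ∀ y, q₀ y ≤ C) {B : Set (Vec d)}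
    (hB : densMeasure p₀ B ≠ 0) {g : Vec d → ℝ} (hg : IsProbDensity g) (x : Vec d) :
    ∫⁻ t in B, klDens (fun y => q₀ (y - x + t)) (flatPredictive p₀ q₀ x) ∂densMeasure p₀ ≤
      ∫⁻ t in B, klDens (fun y => q₀ (y - x + t)) g ∂densMeasure p₀ +
        ENNReal.ofReal (Real.log ((densMeasure p₀).real B)⁻¹) := by
  have := hp.isProbabilityMeasure
  have mq := hq.measurable
  set P := densMeasure p₀ with hP
  set u := P.real B with hu
  have hPu : P B = ENNReal.ofReal u := (ENNReal.ofReal_toReal (measure_ne_top _ _)).symm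
  have hu0 : 0 < u := ENNReal.toReal_pos hB (measure_ne_top _ _)
  have hu1 : u ≤ 1 := measureReal_le_one
  have : IsProbabilityMeasure P[|B] := cond_isProbabilityMeasure hB
  set s : Vec d → Vec d → ℝ := fun t y => q₀ (y - x + t) with hs
  have hsm : Measurable fun w : Vec d × Vec d => s w.1 w.2 := by fun_prop
  have hsd (t : Vec d) : IsProbDensity (s t) := by
    simpa only [hs, sub_add] using hq.comp_sub_right (x - t)
  have hsi (y : Vec d) : Integrable (fun t => s t y) P := integrable_comp_of_le P hq hC _
  have hci (y : Vec d) : Integrable (fun t => s t y) P[|B] := integrable_comp_of_le _ hq hC _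
  have hcd : IsProbDensity fun y => ∫ t, s t y ∂P[|B] := isProbDensity_integral _ hsm hsd hci
  -- Dropping the errors outside `B` only decreases the mixture, and `u` undoes the normalisation of
  -- `P[|B]`.
  have hle (y : Vec d) : u * ∫ t, s t y ∂P[|B] ≤ flatPredictive p₀ q₀ x y := by
    rw [ProbabilityTheory.cond, integral_smul_measure, hPu, ENNReal.toReal_inv,
      ENNReal.toReal_ofReal hu0.le, smul_eq_mul, mul_inv_cancel_left₀ hu0.ne']
    exact setIntegral_le_integral (hsi y) (Filter.Eventually.of_forall fun t => (hsd t).nonneg y)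
  have h1 : ∫⁻ t, klDens (s t) (flatPredictive p₀ q₀ x) ∂P[|B] ≤
      ∫⁻ t, klDens (s t) g ∂P[|B] + ENNReal.ofReal (Real.log u⁻¹) := by
    calc _ ≤ ∫⁻ t, (klDens (s t) (fun y => ∫ t, s t y ∂P[|B]) + ENNReal.ofReal (Real.log u⁻¹))
          ∂P[|B] := lintegral_mono fun t => klDens_le_add_log (hsd t) hcd
            ((isPredictiveDensity_flatPredictive hp hq hC).isProbDensity x) hu0 hu1 hle
      _ = ∫⁻ t, klDens (s t) (fun y => ∫ t, s t y ∂P[|B]) ∂P[|B] +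
          ENNReal.ofReal (Real.log u⁻¹) := by
        rw [lintegral_add_right _ measurable_const]; simp
      _ ≤ _ := by
        exact add_le_add (le_self_add.trans (lintegral_klDens_add_le P[|B] hsm hsd hci hg)) le_rfl
  rw [ProbabilityTheory.cond, lintegral_smul_measure, lintegral_smul_measure] at h1
  have h2 := mul_le_mul_right h1 (P B)
  rw [smul_eq_mul, smul_eq_mul, mul_add, ← mul_assoc, ← mul_assoc,
    ENNReal.mul_inv_cancel hB (measure_ne_top _ _), one_mul, one_mul] at h2
  -- Undoing the conditioning multiplies the logarithmic loss by `P B ≤ 1`, a factor that can be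
  -- discarded.
  exact h2.trans (add_le_add le_rfl (mul_le_of_le_one_left zero_le prob_le_one))

/-- In a location model the flat-prior predictive density is minimax. -/
lemma isMinimaxPredictive_flatPredictive (hp : IsProbDensity p₀) (hq : IsProbDensity q₀)
    {C : ℝ} (hC : ∀ y, q₀ y ≤ C) :
    IsMinimaxPredictive (fun θ x => p₀ (x - θ)) (fun θ y => q₀ (y - θ)) (flatPredictive p₀ q₀) := by
  have hU := isPredictiveDensity_flatPredictive hp hq hC
  refine ⟨hU, fun qhat hd => iSup_le fun θ₀ => ?_⟩
  have := hp.isProbabilityMeasure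
  have mq := hq.measurable
  have md := hd.measurable
  rw [klRisk_location_of_equivariant hq hU isLocationEquivariant_flatPredictive]
  set M := ⨆ θ, klRisk (fun θ x => p₀ (x - θ)) (fun θ y => q₀ (y - θ)) θ qhat with hM
  set P := densMeasure p₀ with hP
  set κ : Vec d → ℝ≥0∞ := fun t => klDens (fun y => q₀ (y + t)) (flatPredictive p₀ q₀ 0) with hκ
  set B : ℕ → Set (Vec d) := fun k => Metric.ball 0 (k : ℝ) with hB
  have hBu : ⋃ k, B k = Set.univ := Metric.iUnion_ball_nat 0
  have hBmono : Monotone B := fun i j h => Metric.ball_subset_ball (by exact_mod_cast h)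
  have hsd (x t : Vec d) : IsProbDensity fun y => q₀ (y - x + t) := by
    simpa only [sub_add] using hq.comp_sub_right (x - t)
  have hK : Measurable fun w : Vec d × Vec d =>
      klDens (fun y => q₀ (y - w.1 + w.2)) (qhat w.1) := by
    simp_rw [fun w : Vec d × Vec d => klDens_eq_lintegral (hsd w.1 w.2) (hd.isProbDensity w.1)]
    have : Measurable fun w : (Vec d × Vec d) × Vec d =>
        klIntegrand (q₀ (w.2 - w.1.1 + w.1.2)) (qhat w.1.1 w.2) := by
      have : Measurable fun w : (Vec d × Vec d) × Vec d => qhat w.1.1 w.2 :=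
        md.comp (g := fun w : Vec d × Vec d => qhat w.1 w.2) (by fun_prop :
          Measurable fun w : (Vec d × Vec d) × Vec d => (w.1.1, w.2))
      fun_prop
    exact this.lintegral_prod_right'
  have hu : Filter.Tendsto (fun k => P (B k)) Filter.atTop (nhds 1) := by
    have := tendsto_measure_iUnion_atTop (μ := P) hBmono
    rwa [hBu, measure_univ] at this
  have hur : Filter.Tendsto (fun k => P.real (B k)) Filter.atTop (nhds 1) :=
    (ENNReal.tendsto_toReal ENNReal.one_ne_top).comp hu
  have hε : Filter.Tendsto (fun k => M + ENNReal.ofReal (Real.log (P.real (B k))⁻¹)) Filter.atTop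
      (nhds M) := by
    have h1 := (hur.inv₀ one_ne_zero).log (by simp)
    have h2 := (ENNReal.tendsto_ofReal h1).const_add M
    simpa using h2
  -- Continuity from below of the measure with density `κ`; the limit may be infinite.
  have hI : Filter.Tendsto (fun k => ∫⁻ t in B k, κ t ∂P) Filter.atTop
      (nhds (∫⁻ t, κ t ∂P)) := by
    have := tendsto_measure_iUnion_atTop (μ := P.withDensity κ) hBmono
    rw [hBu, withDensity_apply _ .univ, Measure.restrict_univ] at this
    refine this.congr fun k => withDensity_apply _ measurableSet_ball
  refine le_of_tendsto_of_tendsto hI hε ?_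
  -- Conditioning on `B k` requires positive probability, which holds for large `k`.
  filter_upwards [hu.eventually_ne one_ne_zero] with k hk
  refine le_add_of_forall_lintegral_le P
    (K := fun x t => klDens (fun y => q₀ (y - x + t)) (qhat x)) hK (fun θ => ?_) (Nat.cast_nonneg k) fun x => ?_
  · refine le_trans (le_of_eq ?_) (le_iSup _ θ)
    rw [klRisk_location]
    refine lintegral_congr fun t => ?_
    congr 1; ext y; congr 1; abel
  · have h := setLIntegral_klDens_flatPredictive_le hp hq hC hk (hd.isProbDensity x) x
    -- By equivariance the flat predictive's divergence at error `t` does not depend on `x`, so the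
    -- lower bound is uniform in `x`.
    have e (t : Vec d) : klDens (fun y => q₀ (y - x + t)) (flatPredictive p₀ q₀ x) = κ t := by
      rw [← klDens_comp_add_right (hsd x t) (hU.isProbDensity x) x]
      have e0 : (fun y => flatPredictive p₀ q₀ x (y + x)) = flatPredictive p₀ q₀ 0 := by
        ext y; simp [flatPredictive]
      simp [hκ, e0]
    simp_rw [e] at h
    exact h

end

/-! ### Convolution of normal densities -/

lemma normalPDF_le {S : Matrix (Fin d) (Fin d) ℝ} (hS : S.PosDef) (z : Vec d) :
    normalPDF S z ≤ (Real.sqrt ((2 * Real.pi) ^ d * S.det))⁻¹ := by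
  unfold normalPDF
  apply mul_le_of_le_one_right (by positivity)
  rw [Real.exp_le_one_iff]
  have := hS.inv.posSemidef.dotProduct_mulVec_nonneg z.ofLp
  simp only [star_trivial] at this
  linarith

@[fun_prop]
lemma measurable_normalPDF (S : Matrix (Fin d) (Fin d) ℝ) : Measurable (normalPDF S) :=
  (continuous_normalPDF S).measurable

lemma normalPDF_neg (S : Matrix (Fin d) (Fin d) ℝ) (z : Vec d) :
    normalPDF S (-z) = normalPDF S z := by
  simp [normalPDF, Matrix.mulVec_neg]

lemma isProbDensity_of_densMeasure_eq {f : Vec d → ℝ} {μ : Measure (Vec d)}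
    [IsProbabilityMeasure μ] (hf : Measurable f) (hf0 : ∀ y, 0 ≤ f y) (h : densMeasure f = μ) :
    IsProbDensity f := by
  refine ⟨hf, hf0, ?_⟩
  have h1 : densMeasure f Set.univ = 1 := by rw [h, measure_univ]
  rwa [densMeasure, withDensity_apply _ .univ, Measure.restrict_univ] at h1

lemma isProbDensity_normalPDF {S : Matrix (Fin d) (Fin d) ℝ} (hS : S.PosDef) :
    IsProbDensity (normalPDF S) :=
  isProbDensity_of_densMeasure_eq (measurable_normalPDF S) (normalPDF_nonneg S)
    (multivariateGaussian_eq_densMeasure hS).symm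

lemma integrable_normalPDF {S : Matrix (Fin d) (Fin d) ℝ} (hS : S.PosDef) :
    Integrable (normalPDF S) := by
  by_contra h
  have := (isProbDensity_normalPDF hS).integral_eq_one
  rw [integral_undef h] at this
  exact zero_ne_one this

/-- Characteristic functions multiply, so the covariance forms in the exponents add. -/
lemma multivariateGaussian_conv {S T : Matrix (Fin d) (Fin d) ℝ} (hS : S.PosDef) (hT : T.PosDef) :
    (multivariateGaussian (0 : Vec d) S ∗ multivariateGaussian (0 : Vec d) T) =
      multivariateGaussian (0 : Vec d) (S + T) := by
  apply Measure.ext_of_charFun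
  ext t
  rw [charFun_conv, charFun_multivariateGaussian hS.posSemidef,
    charFun_multivariateGaussian hT.posSemidef,
    charFun_multivariateGaussian (hS.add hT).posSemidef, ← Complex.exp_add]
  simp only [inner_zero_right, Complex.ofReal_zero, zero_mul, zero_sub, Matrix.add_mulVec,
    dotProduct_add, Complex.ofReal_add]
  congr 1; ring

/-- The convolution of two normal densities is a normal density. -/
lemma integral_normalPDF_mul {S T : Matrix (Fin d) (Fin d) ℝ} (hS : S.PosDef) (hT : T.PosDef)
    (z : Vec d) : ∫ t, normalPDF T (z - t) * normalPDF S t = normalPDF (S + T) z := by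
  set c : Vec d → ℝ := fun z => ∫ t, normalPDF T (z - t) * normalPDF S t with hc
  have hSi := integrable_normalPDF hS
  have hST := hS.add hT
  have cS := continuous_normalPDF S
  have cT := continuous_normalPDF T
  -- Comparing laws identifies densities only almost everywhere; continuity of both sides upgrades
  -- this to every `z`.
  have cont : Continuous c := by
    refine continuous_of_dominated (F := fun z t => normalPDF T (z - t) * normalPDF S t)
      (bound := fun t => (Real.sqrt ((2 * Real.pi) ^ d * T.det))⁻¹ * normalPDF S t)
      (fun z => (Continuous.aestronglyMeasurable (by fun_prop)))
      (fun z => Filter.Eventually.of_forall fun t => ?_) (hSi.const_mul _)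
      (Filter.Eventually.of_forall fun t => by fun_prop)
    rw [Real.norm_of_nonneg (mul_nonneg (normalPDF_nonneg _ _) (normalPDF_nonneg _ _))]
    exact mul_le_mul_of_nonneg_right (normalPDF_le hT _) (normalPDF_nonneg _ _)
  have hi (z : Vec d) : Integrable fun t => normalPDF T (z - t) * normalPDF S t :=
    hSi.bdd_mul (c := (Real.sqrt ((2 * Real.pi) ^ d * T.det))⁻¹)
      (Continuous.aestronglyMeasurable (by fun_prop)) (Filter.Eventually.of_forall fun t => by
      rw [Real.norm_of_nonneg (normalPDF_nonneg _ _)]; exact normalPDF_le hT _)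
  have h0 (z : Vec d) : 0 ≤ c z := integral_nonneg fun t =>
    mul_nonneg (normalPDF_nonneg _ _) (normalPDF_nonneg _ _)
  have hdens : densMeasure c = densMeasure (normalPDF (S + T)) := by
    rw [← multivariateGaussian_eq_densMeasure hST, ← multivariateGaussian_conv hS hT,
      multivariateGaussian_eq_densMeasure hS, multivariateGaussian_eq_densMeasure hT]
    have := (isProbDensity_normalPDF hS).isProbabilityMeasure
    have := (isProbDensity_normalPDF hT).isProbabilityMeasure
    refine Measure.ext_of_lintegral _ fun f hf => ?_
    rw [Measure.lintegral_conv hf]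
    simp only [densMeasure]
    have mc := cont.measurable
    rw [lintegral_withDensity_eq_lintegral_mul _ (by fun_prop) hf,
      lintegral_withDensity_eq_lintegral_mul _ (by fun_prop) (by
        exact Measurable.lintegral_prod_right' (f := fun w : Vec d × Vec d => f (w.1 + w.2))
          (by fun_prop))]
    have e1 (x : Vec d) : ∫⁻ y, f (x + y) ∂volume.withDensity
        (fun y => ENNReal.ofReal (normalPDF T y)) =
        ∫⁻ z, ENNReal.ofReal (normalPDF T (z - x)) * f z := by
      rw [lintegral_withDensity_eq_lintegral_mul _ (by fun_prop) (by fun_prop),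
        ← lintegral_add_left_eq_self (fun z => ENNReal.ofReal (normalPDF T (z - x)) * f z) x]
      simp
    simp only [Pi.mul_apply, e1]
    simp_rw [← fun x => lintegral_const_mul (μ := (volume : Measure (Vec d)))
      (ENNReal.ofReal (normalPDF S x))
      (show Measurable fun z => ENNReal.ofReal (normalPDF T (z - x)) * f z by fun_prop)]
    rw [lintegral_lintegral_swap (by fun_prop)]
    refine lintegral_congr fun z => ?_
    rw [hc, ofReal_integral_eq_lintegral_ofReal (hi z) (Filter.Eventually.of_forall fun t =>
      mul_nonneg (normalPDF_nonneg _ _) (normalPDF_nonneg _ _)),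
      ← lintegral_mul_const _ (by fun_prop)]
    refine lintegral_congr fun t => ?_
    rw [ENNReal.ofReal_mul (normalPDF_nonneg _ _)]
    ring
  have hae : c =ᵐ[volume] normalPDF (S + T) := by
    have hd := isProbDensity_normalPDF hST
    have mc := cont.measurable
    filter_upwards [(withDensity_eq_iff (by fun_prop) (by fun_prop)
      (by rw [hd.lintegral_eq_one]; simp)).mp hdens.symm] with y hy
    exact ((ENNReal.ofReal_eq_ofReal_iff (hd.nonneg y) (h0 y)).mp hy).symm
  exact congrFun ((cont.ae_eq_iff_eq volume (continuous_normalPDF _)).mp hae) z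

/-! ### Mean mixtures of normal distributions -/

lemma mmnPDF_eq_zero_sub (a : Vec d) (S : Matrix (Fin d) (Fin d) ℝ) (L : Measure ℝ) :
    mmnPDF a S L = fun θ x => mmnPDF a S L 0 (x - θ) := by
  ext θ x; simp [mmnPDF]

lemma isProbDensity_mmnPDF (a : Vec d) {S : Matrix (Fin d) (Fin d) ℝ} (hS : S.PosDef)
    (L : Measure ℝ) [IsProbabilityMeasure L] (θ : Vec d) : IsProbDensity (mmnPDF a S L θ) := by
  have : IsProbabilityMeasure (mmnLaw θ a S L) :=
    Measure.isProbabilityMeasure_map (Measurable.aemeasurable (by fun_prop))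
  refine isProbDensity_of_densMeasure_eq ?_ (fun x => integral_nonneg fun v => normalPDF_nonneg _ _)
    (densMeasure_mmnPDF θ a hS L)
  exact (StronglyMeasurable.integral_prod_left' (μ := L)
    (f := fun w : ℝ × Vec d => normalPDF S (w.2 - θ - w.1 • a))
    (Measurable.stronglyMeasurable (by fun_prop))).measurable

lemma mmnPDF_le (a : Vec d) {S : Matrix (Fin d) (Fin d) ℝ} (hS : S.PosDef)
    (L : Measure ℝ) [IsProbabilityMeasure L] (θ x : Vec d) :
    mmnPDF a S L θ x ≤ (Real.sqrt ((2 * Real.pi) ^ d * S.det))⁻¹ := by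
  have h := norm_integral_le_of_norm_le_const (μ := L)
    (f := fun v => normalPDF S (x - θ - v • a))
    (C := (Real.sqrt ((2 * Real.pi) ^ d * S.det))⁻¹) (Filter.Eventually.of_forall fun v => by
      rw [Real.norm_of_nonneg (normalPDF_nonneg _ _)]; exact normalPDF_le hS _)
  rw [probReal_univ, mul_one] at h
  exact (Real.le_norm_self _).trans h

/-- Substitute `b - t` for `t` and use that the normal density is even, which turns the integral
into a convolution at `w - (c - b)`. -/
lemma integral_normalPDF_shift_mul {S T : Matrix (Fin d) (Fin d) ℝ} (hS : S.PosDef)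
    (hT : T.PosDef) (w b c : Vec d) :
    ∫ t, normalPDF T (w + t - c) * normalPDF S (t - b) = normalPDF (S + T) (w - (c - b)) := by
  rw [← integral_normalPDF_mul hS hT, ← integral_sub_left_eq_self _ volume b]
  refine integral_congr_ae (Filter.Eventually.of_forall fun t => ?_)
  simp only
  rw [show b - t - b = -t by abel, normalPDF_neg]
  congr 2; abel

/-- The flat-prior predictive density of a mean mixture of normals is again one. -/
lemma flatPredictive_mmnPDF (a : Vec d) {S T : Matrix (Fin d) (Fin d) ℝ} (hS : S.PosDef)
    (hT : T.PosDef) (L₁ L₂ : Measure ℝ) [IsProbabilityMeasure L₁] [IsProbabilityMeasure L₂]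
    (x y : Vec d) :
    flatPredictive (mmnPDF a S L₁ 0) (mmnPDF a T L₂ 0) x y =
      mmnPDF a (S + T) ((L₁.prod L₂).map fun v => v.2 - v.1) x y := by
  have cS := continuous_normalPDF S
  have cT := continuous_normalPDF T
  have cST := continuous_normalPDF (S + T)
  have hST := hS.add hT
  set F : Vec d → ℝ × ℝ → ℝ := fun t v =>
    normalPDF T (y - x + t - v.2 • a) * normalPDF S (t - v.1 • a) with hF
  have hF0 (t : Vec d) (v : ℝ × ℝ) : 0 ≤ F t v :=
    mul_nonneg (normalPDF_nonneg _ _) (normalPDF_nonneg _ _)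
  have hFt (v : ℝ × ℝ) : ∫ t, F t v = normalPDF (S + T) (y - x - (v.2 - v.1) • a) := by
    rw [sub_smul]
    exact integral_normalPDF_shift_mul hS hT _ _ _
  -- `F` is nonnegative and its integral over `t` is a bounded normal density in `v`, hence
  -- integrable for the probability measure `L₁.prod L₂`.
  have hFi : Integrable (Function.uncurry F) (volume.prod (L₁.prod L₂)) := by
    have hm : AEStronglyMeasurable (Function.uncurry F) (volume.prod (L₁.prod L₂)) :=
      Continuous.aestronglyMeasurable (by
        simp only [hF, Function.uncurry_def]
        fun_prop)
    rw [integrable_prod_iff' hm]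
    constructor
    · refine Filter.Eventually.of_forall fun v => ?_
      refine ((integrable_normalPDF hS).comp_sub_right (v.1 • a)).bdd_mul
        (c := (Real.sqrt ((2 * Real.pi) ^ d * T.det))⁻¹)
        (Continuous.aestronglyMeasurable (by fun_prop)) (Filter.Eventually.of_forall fun t => ?_)
      rw [Real.norm_of_nonneg (normalPDF_nonneg _ _)]
      exact normalPDF_le hT _
    · simp only [Function.uncurry_apply_pair, Real.norm_of_nonneg (hF0 _ _), hFt]
      refine Integrable.of_bound (Continuous.aestronglyMeasurable (by fun_prop))
        (Real.sqrt ((2 * Real.pi) ^ d * (S + T).det))⁻¹ (Filter.Eventually.of_forall fun v => ?_)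
      rw [Real.norm_of_nonneg (normalPDF_nonneg _ _)]
      exact normalPDF_le hST _
  calc flatPredictive (mmnPDF a S L₁ 0) (mmnPDF a T L₂ 0) x y
      = ∫ t, ∫ v, F t v ∂(L₁.prod L₂) := by
        rw [flatPredictive, integral_densMeasure (isProbDensity_mmnPDF a hS L₁ 0)]
        refine integral_congr_ae (Filter.Eventually.of_forall fun t => ?_)
        simp only [hF, mmnPDF, sub_zero]
        rw [mul_comm, ← integral_prod_mul]
        refine integral_congr_ae (Filter.Eventually.of_forall fun v => mul_comm _ _)
    _ = ∫ v, (∫ t, F t v) ∂(L₁.prod L₂) := integral_integral_swap hFi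
    _ = _ := by
        simp_rw [hFt]
        rw [mmnPDF, integral_map (by fun_prop) (Continuous.aestronglyMeasurable (by fun_prop))]

end locationModels

theorem mainTheorem9 (d : ℕ) (a : Vec d) (ha : a ≠ 0)
    (SX SY : Matrix (Fin d) (Fin d) ℝ) (hSX : SX.PosDef) (hSY : SY.PosDef)
    (L₁ L₂ L₃ : Measure ℝ) [IsProbabilityMeasure L₁] [IsProbabilityMeasure L₂]
    -- `L₃` is the law of `V₂ - V₁`, with `V₁ ∼ L₁` and `V₂ ∼ L₂` independent
    (hL₃ : L₃ = (L₁.prod L₂).map (fun v => v.2 - v.1))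
    (p q : Vec d → Vec d → ℝ)
    -- the densities of `X | θ` and `Y | θ`
    (hp : p = mmnPDF a SX L₁) (hq : q = mmnPDF a SY L₂)
    (qU : Vec d → Vec d → ℝ)
    -- the Bayes predictive density for the uniform prior `π(θ) = 1`
    (hqU : qU = bayesPredictive p q (fun _ => 1) volume) :
    -- `qU` is the MRE predictive density: it is one, and it is the only one if its risk is finite
    (IsMRE p q qU ∧
      ((∃ θ, klRisk p q θ qU ≠ ∞) →
        ∀ qhat : Vec d → Vec d → ℝ, IsMRE p q qhat → ∀ x, qhat x =ᵐ[volume] qU x)) ∧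
    -- `qU(·; x)` is the density of `MMN_d(x, a, SX + SY, L₃)`
    (∀ x, densMeasure (qU x) = mmnLaw x a (SX + SY) L₃ ∧
      ∀ y, qU x y = mmnPDF a (SX + SY) L₃ x y) ∧
    -- the flat-prior posterior needs no normalisation: `qU(y; x) = ∫ q(y | θ) p(x | θ) dθ`
    (∀ x, (∫ θ, p θ x) = 1 ∧ ∀ y, qU x y = ∫ θ, q θ y * p θ x) ∧
    IsMinimaxPredictive p q qU := by
  have hp₀ := isProbDensity_mmnPDF a hSX L₁ 0
  have hq₀ := isProbDensity_mmnPDF a hSY L₂ 0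
  have hC := mmnPDF_le a hSY L₂ 0
  have : IsProbabilityMeasure L₃ :=
    hL₃ ▸ Measure.isProbabilityMeasure_map (Measurable.aemeasurable (by fun_prop))
  have hp' : p = fun θ x => mmnPDF a SX L₁ 0 (x - θ) := hp.trans (mmnPDF_eq_zero_sub a SX L₁)
  have hq' : q = fun θ y => mmnPDF a SY L₂ 0 (y - θ) := hq.trans (mmnPDF_eq_zero_sub a SY L₂)
  -- Seen as a function of `θ`, the likelihood is a reflected translate of a probability density, so
  -- the denominator in `bayesPredictive` is `1`.
  have hp1 (x : Vec d) : ∫ θ, p θ x = 1 := by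
    rw [hp', integral_sub_left_eq_self (mmnPDF a SX L₁ 0) volume x, hp₀.integral_eq_one]
  have hqp (x y : Vec d) : qU x y = ∫ θ, q θ y * p θ x := by
    simp [hqU, bayesPredictive, hp1]
  have hU : qU = flatPredictive (mmnPDF a SX L₁ 0) (mmnPDF a SY L₂ 0) := by
    ext x y
    rw [hqp, hp', hq', integral_mul_eq_flatPredictive hp₀]
  have hmix (x y : Vec d) : qU x y = mmnPDF a (SX + SY) L₃ x y := by
    rw [hU, hL₃, flatPredictive_mmnPDF a hSX hSY]
  refine ⟨⟨?_, ?_⟩, fun x => ⟨?_, hmix x⟩, fun x => ⟨hp1 x, hqp x⟩, ?_⟩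
  · rw [hp', hq', hU]
    exact isMRE_flatPredictive hp₀ hq₀ hC
  · rintro ⟨θ, hθ⟩ qhat h x
    rw [hp', hq', hU] at hθ
    rw [hp', hq'] at h
    rw [hU]
    exact h.ae_eq_flatPredictive hp₀ hq₀ hC hθ x
  · rw [funext (hmix x)]
    exact densMeasure_mmnPDF x a (hSX.add hSY) L₃
  · rw [hp', hq', hU]
    exact isMinimaxPredictive_flatPredictive hp₀ hq₀ hC
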